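/- Let $K:\mathbb{R}^2\to\mathbb{R}$ be continuously differentiable on $\mathbb{R}^2\setminus\{0\}$ and weakly singular at the origin, i.e. there are $\alpha<2$ and $D>0$ such that $|K(\mathbf r)|\le D|\mathbf r|^{-\alpha}$ for all $\mathbf r\neq 0$ in a neighbourhood of $0$. Let $S\subset\mathbb{R}^2$ be a bounded closed region with piecewise smooth boundary, i.e. $S$ is compact and $\partial S$ is the union of finitely many regular $C^1$ arcs that meet only at their end points, oriented so that $S$ lies on their left and the complement of $S$ on their right, with positively oriented unit tangent vector $\boldsymbol\tau$ and arclength element $ds$. Let $\rho:S\to\mathbb{R}$ be continuously differentiable on $S$. Then for every point $\mathbf r_*\in S$ such that $S$ is star-shaped with respect to $\mathbf r_*$, all the integrals below converge absolutely and $$\int_{S} K(\mathbf r-\mathbf r_*)\,\rho(\mathbf r)\,dA=\oint_{\partial S}\left(\int_0^1 t\,K\bigl(t(\mathbf r-\mathbf r_*)\bigr)\,\rho\bigl(\mathbf r_*+t(\mathbf r-\mathbf r_*)\bigr)\,dt\right)\bigl((\mathbf r-\mathbf r_*)\times\boldsymbol\tau\bigr)\,ds,$$ where $\mathbf u\times\mathbf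 v=u_1v_2-u_2v_1$. -/

import Mathlib

open Set Filter Topology MeasureTheory

/-- The Euclidean plane. -/
abbrev Plane : Type := EuclideanSpace ℝ (Fin 2)

/-- The scalar cross product `u × v = u₁ v₂ - u₂ v₁` of plane vectors. -/
def cross (u v : Plane) : ℝ := u 0 * v 1 - u 1 * v 0

/-- Rotation of a plane vector by a quarter turn counterclockwise. -/
noncomputable def quarterTurn (v : Plane) : Plane := !₂[-(v 1), v 0]

/-- `K` is weakly singular at the origin: `|K r| ≤ D |r|^(-α)` for some `α < 2` and `D > 0`,
for all `r ≠ 0` in some neighbourhood of the origin. -/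
def IsWeaklySingular (K : Plane → ℝ) : Prop :=
  ∃ α : ℝ, α < 2 ∧ ∃ D : ℝ, 0 < D ∧ ∀ᶠ r in 𝓝[≠] (0 : Plane), |K r| ≤ D * ‖r‖ ^ (-α)

/-- A piecewise smooth, positively oriented parametrization of the boundary of a plane set `S`:
finitely many regular `C¹` arcs, each parametrized by `[0, 1]`, which cover the boundary of `S`,
meet only at their end points (an arc may be closed), and have `S` on their left and the
complement of `S` on their right. -/
structure PiecewiseSmoothBoundary (S : Set Plane) where
  /-- The number of arcs. -/
  n : ℕ
  /-- The arcs; only their values on `[0, 1]` matter. -/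
  arc : Fin n → ℝ → Plane
  contDiffOn_arc : ∀ i, ContDiffOn ℝ 1 (arc i) (Icc 0 1)
  deriv_ne_zero : ∀ i, ∀ t ∈ Icc (0 : ℝ) 1, derivWithin (arc i) (Icc 0 1) t ≠ 0
  /-- An arc does not pass twice through a point other than its end points,
  and different arcs meet only at end points of both of them. -/
  simple : ∀ i j, ∀ s ∈ Ioo (0 : ℝ) 1, ∀ t ∈ Icc (0 : ℝ) 1, arc i s = arc j t → i = j ∧ s = t
  iUnion_arc : ⋃ i, arc i '' Icc 0 1 = frontier S
  left_mem : ∀ i, ∀ t ∈ Ioo (0 : ℝ) 1, ∀ᶠ ε in 𝓝[>] (0 : ℝ),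
    arc i t + ε • quarterTurn (derivWithin (arc i) (Icc 0 1) t) ∈ S
  right_notMem : ∀ i, ∀ t ∈ Ioo (0 : ℝ) 1, ∀ᶠ ε in 𝓝[>] (0 : ℝ),
    arc i t - ε • quarterTurn (derivWithin (arc i) (Icc 0 1) t) ∉ S

namespace PiecewiseSmoothBoundary

variable {S : Set Plane} (B : PiecewiseSmoothBoundary S)

/-- The velocity of the `i`-th arc (one-sided at the end points). -/
noncomputable def velocity (i : Fin B.n) (t : ℝ) : Plane := derivWithin (B.arc i) (Icc 0 1) t

/-- The unit tangent vector `τ` of the `i`-th arc. -/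
noncomputable def unitTangent (i : Fin B.n) (t : ℝ) : Plane :=
  ‖B.velocity i t‖⁻¹ • B.velocity i t

/-- The integrand of `∮ g(r, τ) ds` along the `i`-th arc, with arclength element
`ds = |γ'(t)| dt`. -/
noncomputable def integrand (g : Plane → Plane → ℝ) (i : Fin B.n) (t : ℝ) : ℝ :=
  g (B.arc i t) (B.unitTangent i t) * ‖B.velocity i t‖

/-- The boundary integral `∮ g(r, τ) ds` converges absolutely. -/
def BoundaryIntegrable (g : Plane → Plane → ℝ) : Prop :=
  ∀ i, IntervalIntegrable (B.integrand g i) volume 0 1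

/-- The boundary integral `∮ g(r, τ) ds`, with respect to arclength, of a function of the
boundary point `r` and the positively oriented unit tangent vector `τ` at `r`. -/
noncomputable def boundaryIntegral (g : Plane → Plane → ℝ) : ℝ :=
  ∑ i, ∫ t in (0 : ℝ)..1, B.integrand g i t

end PiecewiseSmoothBoundary

/-!
The segments from `r₀` to a boundary arc `γ` sweep out the cone `(t, s) ↦ r₀ + s (γ t - r₀)`, whose
Jacobian has absolute value `s |(γ t - r₀) × γ' t|`. Since `S` is star-shaped and lies on the left
of its boundary, `(γ t - r₀) × γ' t ≥ 0`, and a ray that crosses the boundary transversally leaves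
`S` for good. Hence the cones over the transversal parts of the arcs are disjoint; by Sard's lemma
the tangential parts contribute a null set, so these cones tile `S` up to measure zero. The change
of variables formula and Fubini's theorem on each cone turn the integral over `S` into the
boundary integral. The only analytic input is integrability over `S`, which holds because
`|r|^(-α)` with `α < 2` is locally integrable in the plane.
-/

open Asymptotics

section Cross

/-- The cross product with a fixed left factor `u`, as a continuous linear functional. -/
noncomputable def crossCLM (u : Plane) : Plane →L[ℝ] ℝ :=
  u 0 • EuclideanSpace.proj 1 - u 1 • EuclideanSpace.proj 0

@[simp]
theorem crossCLM_apply (u v : Plane) : crossCLM u v = cross u v := by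
  simp [crossCLM, cross]

theorem cross_self_eq_zero (u : Plane) : cross u u = 0 := by
  simp [cross, mul_comm]

theorem cross_swap (u v : Plane) : cross u v = -cross v u := by
  simp only [cross]; ring

theorem cross_neg (u v : Plane) : cross u (-v) = -cross u v := by
  simp only [← crossCLM_apply, map_neg]

theorem cross_smul (u v : Plane) (c : ℝ) : cross u (c • v) = c * cross u v := by
  simp only [← crossCLM_apply, map_smul, smul_eq_mul]

theorem cross_quarterTurn (v : Plane) : cross v (quarterTurn v) = ‖v‖ ^ 2 := by
  simp only [EuclideanSpace.norm_sq_eq, Fin.sum_univ_two, Real.norm_eq_abs, sq_abs, cross,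
    quarterTurn]
  simp; ring

theorem continuous_cross : Continuous fun p : Plane × Plane => cross p.1 p.2 := by
  unfold cross; fun_prop

end Cross

section Topology

variable {X Y : Type*} [TopologicalSpace X] [TopologicalSpace Y]

theorem mem_iff_mem_of_isPreconnected_of_disjoint_frontier {s t : Set X} (hs : IsPreconnected s)
    (hst : Disjoint s (frontier t)) {x y : X} (hx : x ∈ s) (hy : y ∈ s) : x ∈ t ↔ y ∈ t := by
  have hsub : s ⊆ interior t ∪ interior tᶜ := by
    rw [← compl_frontier_eq_union_interior]
    exact hst.subset_compl_right
  have hdisj : Disjoint (interior t) (interior tᶜ) :=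
    disjoint_compl_right.mono interior_subset interior_subset
  rcases hs.subset_or_subset isOpen_interior isOpen_interior hdisj hsub with h | h
  · exact iff_of_true (interior_subset (h hx)) (interior_subset (h hy))
  · exact iff_of_false (interior_subset (h hx)) (interior_subset (h hy))

theorem nhdsWithin_image_le_map_nhdsWithin [T2Space Y] {f : X → Y} {K : Set X} (hK : IsCompact K)
    (hf : ContinuousOn f K) {x : X} (hx : ∀ y ∈ K, f y = f x → y = x) :
    𝓝[f '' K] (f x) ≤ map f (𝓝[K] x) := by
  intro s hs
  obtain ⟨U, hUo, hxU, hUs⟩ := mem_nhdsWithin.1 (mem_map.1 hs)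
  have hclosed : IsClosed (f '' (K \ U)) :=
    ((hK.diff hUo).image_of_continuousOn (hf.mono sdiff_subset)).isClosed
  have hfx : f x ∉ f '' (K \ U) := by
    rintro ⟨y, ⟨hyK, hyU⟩, hy⟩
    exact hyU (hx y hyK hy ▸ hxU)
  refine mem_nhdsWithin.2 ⟨_, hclosed.isOpen_compl, hfx, ?_⟩
  rintro _ ⟨hy, y, hyK, rfl⟩
  exact hUs ⟨by_contra fun hyU => hy (mem_image_of_mem f ⟨hyK, hyU⟩), hyK⟩

theorem isBigO_principal_sdiff_singleton {F G : Type*} [SeminormedAddCommGroup F]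
    [NormedAddCommGroup G] {K : Set X} (hK : IsCompact K) {a : X} {f : X → F} {g : X → G}
    (hf : ContinuousOn f (K \ {a})) (hg : ContinuousOn g (K \ {a}))
    (hg₀ : ∀ x ∈ K \ {a}, g x ≠ 0) (hfg : f =O[𝓝[K \ {a}] a] g) :
    f =O[𝓟 (K \ {a})] g := by
  obtain ⟨c, hc⟩ := hfg.bound
  obtain ⟨U, hUo, haU, hUc⟩ := mem_nhdsWithin.1 hc
  have hnear : f =O[𝓟 (U ∩ (K \ {a}))] g := isBigO_principal.2 ⟨c, hUc⟩
  have hsub : K \ U ⊆ K \ {a} := sdiff_subset_sdiff_right (singleton_subset_iff.2 haU)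
  have hfar : f =O[𝓟 (K \ U)] g :=
    ((hf.mono hsub).isBigO_principal (hK.diff hUo) (norm_ne_zero_iff.2 one_ne_zero)).trans
      ((hg.mono hsub).isBigO_rev_principal (hK.diff hUo) (fun x hx => hg₀ x (hsub hx)) (1 : ℝ))
  refine (hnear.sup hfar).mono ?_
  rw [sup_principal, principal_mono]
  exact fun x hx => (em (x ∈ U)).imp (fun h => ⟨h, hx⟩) fun h => ⟨hx.1, h⟩

end Topology

section TopologicalVectorSpace

variable {E : Type*} [AddCommGroup E] [TopologicalSpace E] [IsTopologicalAddGroup E]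
  [Module ℝ E] [ContinuousSMul ℝ E]

theorem eventually_forall_add_smul {a : E} {p : E → Prop} (hp : ∀ᶠ x in 𝓝 a, p x) {C : Set E}
    (hC : IsCompact C) : ∀ᶠ c in 𝓝 (0 : ℝ), ∀ w ∈ C, p (a + c • w) := by
  refine hC.eventually_forall_of_forall_eventually fun w _ => ?_
  have hcont : Continuous fun z : ℝ × E => a + z.1 • z.2 := by fun_prop
  exact (hcont.tendsto' (0, w) a (by simp)).eventually hp

theorem exists_one_le_smul_mem_frontier [T2Space E] {S : Set E} (hS : IsCompact S) {x₀ x : E}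
    (hx : x ∈ S) (hne : x ≠ x₀) : ∃ c : ℝ, 1 ≤ c ∧ c • (x - x₀) + x₀ ∈ frontier S := by
  let ray : ℝ → E := fun c => c • (x - x₀) + x₀
  have hray : IsClosedEmbedding ray :=
    (Homeomorph.addRight x₀).isClosedEmbedding.comp
      (isClosedEmbedding_smul_left (sub_ne_zero.2 hne))
  obtain ⟨c, ⟨hcS, hc1⟩, hmax⟩ :=
    ((hray.isCompact_preimage hS).inter_right isClosed_Ici).exists_isGreatest
      ⟨1, by simpa [ray] using hx, self_mem_Ici⟩
  refine ⟨c, hc1, subset_closure hcS, fun hint => ?_⟩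
  have hnear : ∀ᶠ d in 𝓝[>] c, ray d ∈ S :=
    (hray.continuous.continuousAt.eventually (mem_interior_iff_mem_nhds.1 hint)).filter_mono
      nhdsWithin_le_nhds
  obtain ⟨d, hdS, hcd⟩ := (hnear.and self_mem_nhdsWithin).exists
  exact (hmax ⟨hdS, hc1.trans (le_of_lt hcd)⟩).not_gt hcd

end TopologicalVectorSpace

section Tangent

variable {E : Type*} [NormedAddCommGroup E] [NormedSpace ℝ E]

theorem eventually_forall_sub_ne_smul {γ : ℝ → E} {v : E} {I : Set ℝ} {t : ℝ}
    (hγ : HasDerivWithinAt γ v I t) (hv : v ≠ 0) {ℓ : E →L[ℝ] ℝ} (hℓv : ℓ v = 0)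
    {C : Set E} (hC : IsCompact C) (hℓC : ∀ w ∈ C, ℓ w ≠ 0) :
    ∀ᶠ s in 𝓝[I] t, ∀ c : ℝ, c ≠ 0 → ∀ w ∈ C, γ s - γ t ≠ c • w := by
  -- `ℓ` is little-o of the chord along the chord, but comparable to the norm on multiples of `C`.
  have hchord : (fun s => s - t) =O[𝓝[I] t] fun s => γ s - γ t :=
    (hγ.isTheta_sub hv).isBigO_symm.comp_tendsto
      (tendsto_id.prodMk (tendsto_pure.2 (Eventually.of_forall fun _ => rfl)))
  have htangent : (fun s => ℓ (γ s - γ t)) =o[𝓝[I] t] fun s => γ s - γ t := by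
    have hderiv := ℓ.hasFDerivAt.comp_hasDerivWithinAt t hγ
    rw [hℓv] at hderiv
    simpa using (hasDerivWithinAt_iff_isLittleO.1 hderiv).trans_isBigO hchord
  obtain ⟨c, hc, htransversal⟩ : ∃ c > 0, ∀ w ∈ C, ‖w‖ ≤ c * ‖ℓ w‖ := by
    have hO : (fun w => w) =O[𝓟 C] ℓ :=
      (continuousOn_id.isBigO_principal hC (norm_ne_zero_iff.2 one_ne_zero)).trans
        (ℓ.continuous.continuousOn.isBigO_rev_principal hC hℓC (1 : ℝ))
    simpa only [isBigOWith_principal] using hO.exists_pos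
  filter_upwards [htangent.def (c := (2 * c)⁻¹) (by positivity)] with s hs a ha w hw heq
  have hℓw : 0 < ‖ℓ w‖ := norm_pos_iff.2 (hℓC w hw)
  rw [heq, map_smul, norm_smul, norm_smul, mul_left_comm,
    mul_le_mul_iff_of_pos_left (norm_pos_iff.2 ha), le_inv_mul_iff₀ (by positivity)] at hs
  nlinarith [htransversal w hw]

end Tangent

section WeakSingularity

variable {E : Type*} [NormedAddCommGroup E] [NormedSpace ℝ E] {f : E → ℝ} {S : Set E} {x₀ : E}
  {α : ℝ}

theorem integrableOn_of_isBigO_norm_sub_rpow [FiniteDimensional ℝ E] [Nontrivial E]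
    [MeasurableSpace E] [BorelSpace E] {μ : Measure E} [μ.IsAddHaarMeasure] (hS : IsCompact S)
    (hf : ContinuousOn f (S \ {x₀})) (hα : α < Module.finrank ℝ E)
    (hfO : f =O[𝓟 (S \ {x₀})] fun x => ‖x - x₀‖ ^ (-α)) : IntegrableOn f S μ := by
  obtain ⟨C, hC⟩ := isBigO_principal.1 hfO
  have hpow : LocallyIntegrable (fun x : E => ‖x‖ ^ (-α)) μ :=
    locallyIntegrable_of_norm_le_rpow (C := 1) Module.finrank_pos hα
      (Eventually.of_forall fun x => by
        rw [Real.norm_of_nonneg (by positivity), one_mul])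
      (measurable_norm.pow_const _).aestronglyMeasurable
  have hpowS : IntegrableOn (fun x => ‖x - x₀‖ ^ (-α)) S μ := by
    have himage := (measurePreserving_sub_right μ x₀).integrableOn_image
      (MeasurableEquiv.subRight x₀).measurableEmbedding
      (f := fun x => ‖x‖ ^ (-α)) (s := S)
    exact himage.1 (hpow.integrableOn_isCompact (hS.image (continuous_sub_right x₀)))
  have hdiff : IntegrableOn f (S \ {x₀}) μ := by
    have hmeas : MeasurableSet (S \ {x₀}) := hS.measurableSet.diff (measurableSet_singleton x₀)
    refine ((hpowS.mono_set sdiff_subset).const_mul C).mono' (hf.aestronglyMeasurable hmeas) ?_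
    filter_upwards [ae_restrict_mem hmeas] with x hx
    exact (hC x hx).trans_eq (by rw [Real.norm_of_nonneg (by positivity)])
  exact hdiff.congr_set_ae (sdiff_null_ae_eq_self (measure_singleton x₀)).symm

theorem intervalIntegrable_mul_comp_smul_sub_add (hstar : StarConvex ℝ x₀ S)
    (hf : ContinuousOn f (S \ {x₀})) (hα : α < 2)
    (hfO : f =O[𝓟 (S \ {x₀})] fun x => ‖x - x₀‖ ^ (-α)) {x : E} (hx : x ∈ S) :
    IntervalIntegrable (fun t : ℝ => t * f (t • (x - x₀) + x₀)) volume 0 1 := by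
  rcases eq_or_ne x x₀ with rfl | hne
  · simp
  obtain ⟨C, hC⟩ := isBigO_principal.1 hfO
  have hmaps : MapsTo (fun t : ℝ => t • (x - x₀) + x₀) (Ioc 0 1) (S \ {x₀}) := fun t ht =>
    ⟨by simpa only [add_comm] using hstar.add_smul_sub_mem hx ht.1.le ht.2,
      by simpa [sub_eq_zero, ht.1.ne'] using hne⟩
  rw [intervalIntegrable_iff_integrableOn_Ioc_of_le zero_le_one]
  have hdom : IntegrableOn (fun t : ℝ => C * ‖x - x₀‖ ^ (-α) * t ^ (1 - α)) (Ioc 0 1) :=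
    ((intervalIntegrable_iff_integrableOn_Ioc_of_le zero_le_one).1
      (intervalIntegral.intervalIntegrable_rpow' (by linarith))).const_mul _
  refine hdom.mono' ((continuousOn_id.mul (hf.comp (by fun_prop) hmaps)).aestronglyMeasurable
    measurableSet_Ioc) ?_
  filter_upwards [ae_restrict_mem measurableSet_Ioc] with t ht
  calc ‖t * f (t • (x - x₀) + x₀)‖
      ≤ t * (C * (t * ‖x - x₀‖) ^ (-α)) := by
        rw [norm_mul, Real.norm_of_nonneg ht.1.le]
        have hbound := hC _ (hmaps ht)
        rw [add_sub_cancel_right, norm_smul, Real.norm_of_nonneg ht.1.le,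
          Real.norm_of_nonneg (Real.rpow_nonneg (mul_nonneg ht.1.le (norm_nonneg _)) _)] at hbound
        exact mul_le_mul_of_nonneg_left hbound ht.1.le
    _ = C * ‖x - x₀‖ ^ (-α) * t ^ (1 - α) := by
        rw [Real.mul_rpow ht.1.le (norm_nonneg _), sub_eq_add_neg 1 α, Real.rpow_add ht.1,
          Real.rpow_one]
        ring

end WeakSingularity

section ChangeOfVariables

/-- Cartesian coordinates on the plane, as a map into `ℝ × ℝ`, on which Fubini's theorem and the
change of variables formula are available. -/
noncomputable def planeCoord : Plane ≃L[ℝ] ℝ × ℝ :=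
  (EuclideanSpace.equiv (Fin 2) ℝ).trans (ContinuousLinearEquiv.finTwoArrow ℝ ℝ)

theorem measurePreserving_planeCoord : MeasurePreserving planeCoord :=
  (volume_preserving_finTwoArrow ℝ).comp (PiLp.volume_preserving_ofLp (Fin 2))

theorem measurableEmbedding_planeCoord : MeasurableEmbedding planeCoord :=
  planeCoord.toHomeomorph.measurableEmbedding

theorem volume_image_planeCoord (X : Set Plane) : volume (planeCoord '' X) = volume X := by
  rw [← measurePreserving_planeCoord.measure_preimage_emb measurableEmbedding_planeCoord,
    preimage_image_eq _ planeCoord.injective]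

theorem det_planeCoord_comp (L : ℝ × ℝ →L[ℝ] Plane) :
    ((planeCoord : Plane →L[ℝ] ℝ × ℝ) ∘L L).det = cross (L (1, 0)) (L (0, 1)) := by
  rw [ContinuousLinearMap.det, ← LinearMap.det_toMatrix (Module.Basis.finTwoProd ℝ),
    Matrix.det_fin_two]
  simp [LinearMap.toMatrix_apply, planeCoord, cross]
  ring

variable {φ : ℝ × ℝ → Plane} {φ' : ℝ × ℝ → ℝ × ℝ →L[ℝ] Plane} {A : Set (ℝ × ℝ)}

theorem hasFDerivWithinAt_planeCoord_comp {p : ℝ × ℝ} (hφ : HasFDerivWithinAt φ (φ' p) A p) :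
    HasFDerivWithinAt (planeCoord ∘ φ) ((planeCoord : Plane →L[ℝ] ℝ × ℝ) ∘L φ' p) A p :=
  planeCoord.hasFDerivAt.comp_hasFDerivWithinAt p hφ

theorem volume_image_eq_zero_of_volume_eq_zero (hφ : DifferentiableOn ℝ φ A) (hA : volume A = 0) :
    volume (φ '' A) = 0 := by
  rw [← volume_image_planeCoord, ← image_comp]
  exact addHaar_image_eq_zero_of_differentiableOn_of_addHaar_eq_zero volume
    (planeCoord.differentiable.comp_differentiableOn hφ) hA

theorem volume_image_eq_zero_of_cross_eq_zero
    (hφ : ∀ p ∈ A, HasFDerivWithinAt φ (φ' p) A p)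
    (hcross : ∀ p ∈ A, cross (φ' p (1, 0)) (φ' p (0, 1)) = 0) : volume (φ '' A) = 0 := by
  rw [← volume_image_planeCoord, ← image_comp]
  exact addHaar_image_eq_zero_of_det_fderivWithin_eq_zero volume
    (fun p hp => hasFDerivWithinAt_planeCoord_comp (hφ p hp))
    (fun p hp => (det_planeCoord_comp _).trans (hcross p hp))

theorem integrableOn_image_iff_integrableOn_abs_cross_mul (hA : MeasurableSet A)
    (hφ : ∀ p ∈ A, HasFDerivWithinAt φ (φ' p) A p) (hinj : InjOn φ A) (f : Plane → ℝ) :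
    IntegrableOn f (φ '' A) ↔
      IntegrableOn (fun p => |cross (φ' p (1, 0)) (φ' p (0, 1))| * f (φ p)) A := by
  have himage := measurePreserving_planeCoord.integrableOn_image measurableEmbedding_planeCoord
    (f := f ∘ planeCoord.symm) (s := φ '' A)
  rw [← image_comp, integrableOn_image_iff_integrableOn_abs_det_fderiv_smul volume hA
    (fun p hp => hasFDerivWithinAt_planeCoord_comp (hφ p hp))
    (planeCoord.injective.comp_injOn hinj)] at himage
  simpa [Function.comp_def, det_planeCoord_comp] using himage.symm

theorem setIntegral_image_eq_setIntegral_abs_cross_mul (hA : MeasurableSet A)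
    (hφ : ∀ p ∈ A, HasFDerivWithinAt φ (φ' p) A p) (hinj : InjOn φ A) (f : Plane → ℝ) :
    ∫ r in φ '' A, f r = ∫ p in A, |cross (φ' p (1, 0)) (φ' p (0, 1))| * f (φ p) := by
  have himage := measurePreserving_planeCoord.setIntegral_image_emb measurableEmbedding_planeCoord
    (f ∘ planeCoord.symm) (φ '' A)
  rw [← image_comp, integral_image_eq_integral_abs_det_fderiv_smul volume hA
    (fun p hp => hasFDerivWithinAt_planeCoord_comp (hφ p hp))
    (planeCoord.injective.comp_injOn hinj)] at himage
  simpa [Function.comp_def, det_planeCoord_comp] using himage.symm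

end ChangeOfVariables

section Cone

variable {E : Type*} [NormedAddCommGroup E] [NormedSpace ℝ E]

/-- The cone with apex `r₀` over the curve `γ`, parametrized by pairs `(t, s)` of a time on the
curve and a fraction of the way from the apex to the curve. -/
def coneMap (r₀ : E) (γ : ℝ → E) (p : ℝ × ℝ) : E :=
  p.2 • (γ p.1 - r₀) + r₀

/-- The derivative of `coneMap r₀ γ` at `(t, s)`, where `x = γ t - r₀` and `v` is the velocity
of `γ` at `t`. -/
noncomputable def coneMapDeriv (x v : E) (s : ℝ) : ℝ × ℝ →L[ℝ] E :=
  s • (ContinuousLinearMap.fst ℝ ℝ ℝ).smulRight v + (ContinuousLinearMap.snd ℝ ℝ ℝ).smulRight x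

theorem hasFDerivWithinAt_coneMap {r₀ v : E} {γ : ℝ → E} {I : Set ℝ} {p : ℝ × ℝ}
    (hγ : HasDerivWithinAt γ v I p.1) :
    HasFDerivWithinAt (coneMap r₀ γ) (coneMapDeriv (γ p.1 - r₀) v p.2) (I ×ˢ univ) p := by
  have hγfst : HasFDerivWithinAt (fun q : ℝ × ℝ => γ q.1 - r₀)
      ((ContinuousLinearMap.fst ℝ ℝ ℝ).smulRight v) (I ×ˢ univ) p := by
    simpa using! (hγ.hasFDerivWithinAt.comp p hasFDerivWithinAt_fst
      (mapsTo_fst_prod)).sub_const r₀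
  exact (hasFDerivWithinAt_snd.smul hγfst).add_const r₀

theorem cross_coneMapDeriv (x v : Plane) (s : ℝ) :
    cross (coneMapDeriv x v s (1, 0)) (coneMapDeriv x v s (0, 1)) = -(s * cross x v) := by
  rw [cross_swap]
  simp [coneMapDeriv, cross_smul]

/-- The integral of `f` along the segment from the apex `r₀` to `r`, with the weight `t` that a
planar cone puts on it. -/
noncomputable def radialIntegral (f : E → ℝ) (r₀ r : E) : ℝ :=
  ∫ t in (0 : ℝ)..1, t * f (t • (r - r₀) + r₀)

variable {f : Plane → ℝ} {r₀ : Plane} {γ v : ℝ → Plane} {T : Set ℝ}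

theorem setIntegral_Ioc_cone (t : ℝ) :
    ∫ s in Ioc (0 : ℝ) 1, s * cross (γ t - r₀) (v t) * f (coneMap r₀ γ (t, s)) =
      radialIntegral f r₀ (γ t) * cross (γ t - r₀) (v t) := by
  rw [radialIntegral, intervalIntegral.integral_of_le zero_le_one, ← integral_mul_const]
  simp only [coneMap, mul_right_comm]

theorem integrableOn_and_setIntegral_coneMap_image (hT : MeasurableSet T)
    (hγ : ∀ t ∈ T, HasDerivWithinAt γ (v t) T t) (hcross : ∀ t ∈ T, 0 ≤ cross (γ t - r₀) (v t))
    (hinj : InjOn (coneMap r₀ γ) (T ×ˢ Ioc 0 1))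
    (hf : IntegrableOn f (coneMap r₀ γ '' (T ×ˢ Ioc 0 1))) :
    IntegrableOn (fun t => radialIntegral f r₀ (γ t) * cross (γ t - r₀) (v t)) T ∧
      ∫ r in coneMap r₀ γ '' (T ×ˢ Ioc 0 1), f r =
        ∫ t in T, radialIntegral f r₀ (γ t) * cross (γ t - r₀) (v t) := by
  have hcone : MeasurableSet (T ×ˢ Ioc (0 : ℝ) 1) := hT.prod measurableSet_Ioc
  have hderiv : ∀ p ∈ T ×ˢ Ioc (0 : ℝ) 1, HasFDerivWithinAt (coneMap r₀ γ)
      (coneMapDeriv (γ p.1 - r₀) (v p.1) p.2) (T ×ˢ Ioc 0 1) p := fun p hp =>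
    (hasFDerivWithinAt_coneMap (hγ p.1 hp.1)).mono (prod_mono subset_rfl (subset_univ _))
  have hjacobian : EqOn
      (fun p => |cross (coneMapDeriv (γ p.1 - r₀) (v p.1) p.2 (1, 0))
        (coneMapDeriv (γ p.1 - r₀) (v p.1) p.2 (0, 1))| * f (coneMap r₀ γ p))
      (fun p => p.2 * cross (γ p.1 - r₀) (v p.1) * f (coneMap r₀ γ p)) (T ×ˢ Ioc 0 1) :=
    fun p hp => congrArg (· * _) <| by
      rw [cross_coneMapDeriv, abs_neg, abs_of_nonneg (mul_nonneg hp.2.1.le (hcross p.1 hp.1))]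
  have hint : IntegrableOn (fun p => p.2 * cross (γ p.1 - r₀) (v p.1) * f (coneMap r₀ γ p))
      (T ×ˢ Ioc 0 1) :=
    (integrableOn_congr_fun hjacobian hcone).1
      ((integrableOn_image_iff_integrableOn_abs_cross_mul hcone hderiv hinj f).1 hf)
  rw [setIntegral_image_eq_setIntegral_abs_cross_mul hcone hderiv hinj,
    setIntegral_congr_fun hcone hjacobian, Measure.volume_eq_prod, setIntegral_prod _ hint]
  simp only [setIntegral_Ioc_cone, and_true]
  rw [IntegrableOn, Measure.volume_eq_prod, ← Measure.prod_restrict] at hint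
  simpa only [IntegrableOn, setIntegral_Ioc_cone] using hint.integral_prod_left

end Cone

namespace PiecewiseSmoothBoundary

variable {S : Set Plane} (B : PiecewiseSmoothBoundary S) {r₀ : Plane}

theorem hasDerivWithinAt_arc (i : Fin B.n) {t : ℝ} (ht : t ∈ Icc (0 : ℝ) 1) :
    HasDerivWithinAt (B.arc i) (B.velocity i t) (Icc 0 1) t :=
  ((B.contDiffOn_arc i).differentiableOn one_ne_zero t ht).hasDerivWithinAt

theorem continuousOn_arc (i : Fin B.n) : ContinuousOn (B.arc i) (Icc 0 1) :=
  (B.contDiffOn_arc i).continuousOn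

theorem continuousOn_velocity (i : Fin B.n) : ContinuousOn (B.velocity i) (Icc 0 1) :=
  (B.contDiffOn_arc i).continuousOn_derivWithin (uniqueDiffOn_Icc zero_lt_one) le_rfl

theorem velocity_ne_zero (i : Fin B.n) {t : ℝ} (ht : t ∈ Icc (0 : ℝ) 1) : B.velocity i t ≠ 0 :=
  B.deriv_ne_zero i t ht

theorem arc_mem_frontier (i : Fin B.n) {t : ℝ} (ht : t ∈ Icc (0 : ℝ) 1) :
    B.arc i t ∈ frontier S :=
  B.iUnion_arc ▸ mem_iUnion_of_mem i (mem_image_of_mem _ ht)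

theorem nhdsWithin_frontier_le_map_arc (i : Fin B.n) {t : ℝ} (ht : t ∈ Ioo (0 : ℝ) 1) :
    𝓝[frontier S] (B.arc i t) ≤ map (B.arc i) (𝓝[Icc 0 1] t) := by
  rw [← B.iUnion_arc, nhdsWithin_iUnion]
  refine iSup_le fun j => ?_
  rcases eq_or_ne i j with rfl | hij
  · exact nhdsWithin_image_le_map_nhdsWithin isCompact_Icc (B.continuousOn_arc i)
      fun s hs h => (B.simple i i t ht s hs h.symm).2.symm
  · have hclosed : IsClosed (B.arc j '' Icc 0 1) :=
      (isCompact_Icc.image_of_continuousOn (B.continuousOn_arc j)).isClosed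
    have hnotMem : B.arc i t ∉ B.arc j '' Icc 0 1 := by
      rintro ⟨s, hs, h⟩
      exact hij (B.simple i j t ht s hs h.symm).1
    rw [notMem_closure_iff_nhdsWithin_eq_bot.1 (hclosed.closure_eq.symm ▸ hnotMem)]
    exact bot_le

theorem eventually_forall_add_smul_notMem_frontier (i : Fin B.n) {t : ℝ} (ht : t ∈ Ioo (0 : ℝ) 1)
    {C : Set Plane} (hC : IsCompact C) (hCv : ∀ w ∈ C, cross (B.velocity i t) w ≠ 0) :
    ∀ᶠ ε in 𝓝[>] (0 : ℝ), ∀ w ∈ C, B.arc i t + ε • w ∉ frontier S := by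
  have ht' := Ioo_subset_Icc_self ht
  have hfrontier : ∀ᶠ x in 𝓝[frontier S] (B.arc i t),
      ∀ c : ℝ, c ≠ 0 → ∀ w ∈ C, x - B.arc i t ≠ c • w :=
    (eventually_map.2 <| eventually_forall_sub_ne_smul (B.hasDerivWithinAt_arc i ht')
      (B.velocity_ne_zero i ht') (ℓ := crossCLM (B.velocity i t)) (by simp [cross_self_eq_zero])
      hC (by simpa using hCv)).filter_mono (B.nhdsWithin_frontier_le_map_arc i ht)
  have hnear := eventually_forall_add_smul (eventually_nhdsWithin_iff.1 hfrontier) hC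
  filter_upwards [hnear.filter_mono nhdsWithin_le_nhds, self_mem_nhdsWithin] with ε h hε w hw hmem
  exact h w hw hmem ε (ne_of_gt hε) w hw (add_sub_cancel_left _ _)

theorem eventually_add_smul_mem_iff (i : Fin B.n) {t : ℝ} (ht : t ∈ Ioo (0 : ℝ) 1) {u w : Plane}
    (huw : ∀ z ∈ segment ℝ u w, cross (B.velocity i t) z ≠ 0) :
    ∀ᶠ ε in 𝓝[>] (0 : ℝ), (B.arc i t + ε • u ∈ S ↔ B.arc i t + ε • w ∈ S) := by
  have hcompact : IsCompact (segment ℝ u w) := by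
    rw [← convexHull_pair]
    exact (toFinite _).isCompact_convexHull ℝ
  filter_upwards [B.eventually_forall_add_smul_notMem_frontier i ht hcompact huw] with ε hε
  have himage : IsPreconnected ((fun z => B.arc i t + ε • z) '' segment ℝ u w) :=
    (convex_segment u w).isPreconnected.image _ (by fun_prop)
  refine mem_iff_mem_of_isPreconnected_of_disjoint_frontier himage ?_
    (mem_image_of_mem _ (left_mem_segment ℝ u w)) (mem_image_of_mem _ (right_mem_segment ℝ u w))
  rw [Set.disjoint_left]
  rintro _ ⟨z, hz, rfl⟩
  exact hε z hz

theorem cross_velocity_quarterTurn_pos (i : Fin B.n) {t : ℝ} (ht : t ∈ Icc (0 : ℝ) 1) :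
    0 < cross (B.velocity i t) (quarterTurn (B.velocity i t)) := by
  rw [cross_quarterTurn]
  exact pow_pos (norm_pos_iff.2 (B.velocity_ne_zero i ht)) 2

theorem eventually_add_smul_notMem (i : Fin B.n) {t : ℝ} (ht : t ∈ Ioo (0 : ℝ) 1) {u : Plane}
    (hu : cross (B.velocity i t) u < 0) : ∀ᶠ ε in 𝓝[>] (0 : ℝ), B.arc i t + ε • u ∉ S := by
  have hsegment : segment ℝ (-quarterTurn (B.velocity i t)) u ⊆
      {z | crossCLM (B.velocity i t) z < 0} :=
    (convex_halfSpace_lt (crossCLM _).isLinear 0).segment_subset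
      (by simpa [cross_neg] using B.cross_velocity_quarterTurn_pos i (Ioo_subset_Icc_self ht))
      (by simpa using hu)
  filter_upwards [B.right_notMem i t ht, B.eventually_add_smul_mem_iff i ht fun z hz => by
    simpa using (hsegment hz).ne] with ε hright hiff
  rw [← hiff, smul_neg, ← sub_eq_add_neg]
  exact hright

theorem cross_velocity_nonneg (hS : IsClosed S) (hstar : StarConvex ℝ r₀ S) (i : Fin B.n) {t : ℝ}
    (ht : t ∈ Ioo (0 : ℝ) 1) : 0 ≤ cross (B.arc i t - r₀) (B.velocity i t) := by
  by_contra! hneg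
  -- Otherwise the segment from the arc towards `r₀` leaves `S` on the right of the arc.
  have hinward : cross (B.velocity i t) (r₀ - B.arc i t) < 0 := by
    rwa [← neg_sub, cross_neg, ← cross_swap]
  obtain ⟨ε, hε, hε₀, hε₁⟩ := ((B.eventually_add_smul_notMem i ht hinward).and
    (Ioo_mem_nhdsGT zero_lt_one)).exists
  refine hε ?_
  convert hstar.add_smul_sub_mem (hS.frontier_subset (B.arc_mem_frontier i
    (Ioo_subset_Icc_self ht))) (sub_nonneg.2 hε₁.le) (sub_le_self 1 hε₀.le) using 1
  module

theorem smul_sub_add_notMem (hstar : StarConvex ℝ r₀ S) (i : Fin B.n) {t : ℝ}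
    (ht : t ∈ Ioo (0 : ℝ) 1) (hpos : 0 < cross (B.arc i t - r₀) (B.velocity i t)) {c : ℝ}
    (hc : 1 < c) : c • (B.arc i t - r₀) + r₀ ∉ S := by
  intro hmem
  -- Otherwise `S` contains the segment from the arc to that point, which starts on the right.
  have houtward : cross (B.velocity i t) (B.arc i t - r₀) < 0 := by
    rwa [cross_swap, neg_lt_zero]
  obtain ⟨ε, hε, hε₀, hεc⟩ := ((B.eventually_add_smul_notMem i ht houtward).and
    (Ioo_mem_nhdsGT (sub_pos.2 hc))).exists
  refine hε ?_
  have hc₀ : 0 < c := zero_lt_one.trans hc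
  have hle : (1 + ε) / c ≤ 1 := (div_le_one hc₀).2 (by linarith)
  convert hstar.add_smul_sub_mem hmem (by positivity) hle using 1
  rw [add_sub_cancel_right, smul_smul, div_mul_cancel₀ _ hc₀.ne']
  module

/-- The times, other than the end points, at which the `i`-th arc is transversal to the ray from
`r₀` and runs counterclockwise around `r₀`. -/
def transversalTimes (r₀ : Plane) (i : Fin B.n) : Set ℝ :=
  {t ∈ Ioo (0 : ℝ) 1 | 0 < cross (B.arc i t - r₀) (B.velocity i t)}

theorem transversalTimes_subset_Icc (r₀ : Plane) (i : Fin B.n) :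
    B.transversalTimes r₀ i ⊆ Icc 0 1 :=
  fun _ ht => Ioo_subset_Icc_self ht.1

theorem measurableSet_transversalTimes (r₀ : Plane) (i : Fin B.n) :
    MeasurableSet (B.transversalTimes r₀ i) := by
  have hcont : ContinuousOn (fun t => cross (B.arc i t - r₀) (B.velocity i t)) (Icc 0 1) :=
    continuous_cross.comp_continuousOn
      (((B.continuousOn_arc i).sub continuousOn_const).prodMk (B.continuousOn_velocity i))
  exact ((hcont.mono Ioo_subset_Icc_self).isOpen_inter_preimage isOpen_Ioo isOpen_Ioi).measurableSet

/-- The sector of `S` swept out by the segments from `r₀` to the points of the `i`-th arc at its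
transversal times. -/
def sector (r₀ : Plane) (i : Fin B.n) : Set Plane :=
  coneMap r₀ (B.arc i) '' (B.transversalTimes r₀ i ×ˢ Ioc 0 1)

theorem cross_velocity_eq_zero (hS : IsClosed S) (hstar : StarConvex ℝ r₀ S) (i : Fin B.n) {t : ℝ}
    (ht : t ∈ Ioo (0 : ℝ) 1) (htrans : t ∉ B.transversalTimes r₀ i) :
    cross (B.arc i t - r₀) (B.velocity i t) = 0 :=
  (not_lt.1 fun h => htrans ⟨ht, h⟩).antisymm (B.cross_velocity_nonneg hS hstar i ht)

theorem coneMap_arc_mem (hS : IsClosed S) (hstar : StarConvex ℝ r₀ S) (i : Fin B.n) {p : ℝ × ℝ}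
    (hp : p ∈ Icc (0 : ℝ) 1 ×ˢ Icc (0 : ℝ) 1) : coneMap r₀ (B.arc i) p ∈ S := by
  rw [coneMap, add_comm]
  exact hstar.add_smul_sub_mem (hS.frontier_subset (B.arc_mem_frontier i hp.1)) hp.2.1 hp.2.2

theorem exists_coneMap_arc_eq (hS : IsCompact S) {r : Plane} (hr : r ∈ S) (hne : r ≠ r₀) :
    ∃ i, ∃ p ∈ Icc (0 : ℝ) 1 ×ˢ Ioc (0 : ℝ) 1, coneMap r₀ (B.arc i) p = r := by
  obtain ⟨c, hc, hfrontier⟩ := exists_one_le_smul_mem_frontier hS hr hne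
  rw [← B.iUnion_arc] at hfrontier
  obtain ⟨i, t, ht, harc⟩ := mem_iUnion.1 hfrontier
  have hc₀ : 0 < c := zero_lt_one.trans_le hc
  exact ⟨i, (t, c⁻¹), ⟨ht, inv_pos.2 hc₀, inv_le_one_of_one_le₀ hc⟩,
    by simp [coneMap, harc, hc₀.ne']⟩

theorem snd_le_of_coneMap_arc_eq (hS : IsClosed S) (hstar : StarConvex ℝ r₀ S) {i j : Fin B.n}
    {p q : ℝ × ℝ} (hp : p ∈ B.transversalTimes r₀ i ×ˢ Ioc (0 : ℝ) 1)
    (hq : q ∈ Icc (0 : ℝ) 1 ×ˢ Ioc (0 : ℝ) 1)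
    (h : coneMap r₀ (B.arc i) p = coneMap r₀ (B.arc j) q) : p.2 ≤ q.2 := by
  by_contra! hlt
  refine B.smul_sub_add_notMem hstar i hp.1.1 hp.1.2 ((one_lt_div hq.2.1).2 hlt) ?_
  have hray : p.2 • (B.arc i p.1 - r₀) = q.2 • (B.arc j q.1 - r₀) := add_right_cancel h
  rw [div_eq_inv_mul, mul_smul, hray, inv_smul_smul₀ hq.2.1.ne', sub_add_cancel]
  exact hS.frontier_subset (B.arc_mem_frontier j hq.1)

theorem eq_of_coneMap_arc_eq (hS : IsClosed S) (hstar : StarConvex ℝ r₀ S) {i j : Fin B.n}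
    {p q : ℝ × ℝ} (hp : p ∈ B.transversalTimes r₀ i ×ˢ Ioc (0 : ℝ) 1)
    (hq : q ∈ B.transversalTimes r₀ j ×ˢ Ioc (0 : ℝ) 1)
    (h : coneMap r₀ (B.arc i) p = coneMap r₀ (B.arc j) q) : i = j ∧ p = q := by
  have hp' := B.transversalTimes_subset_Icc r₀ i hp.1
  have hq' := B.transversalTimes_subset_Icc r₀ j hq.1
  have hsnd : p.2 = q.2 := le_antisymm (B.snd_le_of_coneMap_arc_eq hS hstar hp ⟨hq', hq.2⟩ h)
    (B.snd_le_of_coneMap_arc_eq hS hstar hq ⟨hp', hp.2⟩ h.symm)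
  have hray : p.2 • (B.arc i p.1 - r₀) = q.2 • (B.arc j q.1 - r₀) := add_right_cancel h
  rw [hsnd] at hray
  have harc := sub_left_injective (smul_right_injective _ hq.2.1.ne' hray)
  exact (B.simple i j p.1 hp.1.1 q.1 hq' harc).imp_right fun hfst => Prod.ext hfst hsnd

theorem volume_coneMap_image_sdiff_transversalTimes (hS : IsClosed S) (hstar : StarConvex ℝ r₀ S)
    (i : Fin B.n) :
    volume (coneMap r₀ (B.arc i) '' ((Icc 0 1 \ B.transversalTimes r₀ i) ×ˢ univ)) = 0 := by
  have hderiv : ∀ p ∈ Icc (0 : ℝ) 1 ×ˢ univ, HasFDerivWithinAt (coneMap r₀ (B.arc i))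
      (coneMapDeriv (B.arc i p.1 - r₀) (B.velocity i p.1) p.2) (Icc 0 1 ×ˢ univ) p :=
    fun p hp => hasFDerivWithinAt_coneMap (B.hasDerivWithinAt_arc i hp.1)
  have hends : volume (coneMap r₀ (B.arc i) '' ({0, 1} ×ˢ univ)) = 0 := by
    refine volume_image_eq_zero_of_volume_eq_zero (fun p hp => ?_) ?_
    · have hsub : ({0, 1} : Set ℝ) ⊆ Icc 0 1 := by simp [insert_subset_iff]
      exact ((hderiv p ⟨hsub hp.1, hp.2⟩).mono (prod_mono_left hsub)).differentiableWithinAt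
    · rw [Measure.volume_eq_prod, Measure.prod_prod, (toFinite _).measure_zero, zero_mul]
  have htangent : volume (coneMap r₀ (B.arc i) '' ((Ioo 0 1 \ B.transversalTimes r₀ i) ×ˢ univ)) =
      0 := by
    have hsub : Ioo 0 1 \ B.transversalTimes r₀ i ⊆ Icc 0 1 :=
      sdiff_subset.trans Ioo_subset_Icc_self
    refine volume_image_eq_zero_of_cross_eq_zero
      (fun p hp => (hderiv p ⟨hsub hp.1, hp.2⟩).mono (prod_mono_left hsub)) fun p hp => ?_
    rw [cross_coneMapDeriv, B.cross_velocity_eq_zero hS hstar i hp.1.1 hp.1.2, mul_zero, neg_zero]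
  refine measure_mono_null ?_ (measure_union_null hends htangent)
  rw [← image_union, ← union_prod]
  refine image_mono (prod_mono_left fun t ht => ?_)
  exact (em (t ∈ {0, 1})).imp_right fun h => ⟨Icc_sdiff_both (a := (0 : ℝ)) ▸ ⟨ht.1, h⟩, ht.2⟩

theorem sector_subset (hS : IsClosed S) (hstar : StarConvex ℝ r₀ S) (i : Fin B.n) :
    B.sector r₀ i ⊆ S := by
  rintro _ ⟨p, hp, rfl⟩
  exact B.coneMap_arc_mem hS hstar i
    ⟨B.transversalTimes_subset_Icc r₀ i hp.1, Ioc_subset_Icc_self hp.2⟩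

theorem injOn_coneMap_arc (hS : IsClosed S) (hstar : StarConvex ℝ r₀ S) (i : Fin B.n) :
    InjOn (coneMap r₀ (B.arc i)) (B.transversalTimes r₀ i ×ˢ Ioc 0 1) :=
  fun _ hp _ hq h => (B.eq_of_coneMap_arc_eq hS hstar hp hq h).2

theorem pairwise_disjoint_sector (hS : IsClosed S) (hstar : StarConvex ℝ r₀ S) :
    Pairwise fun i j => Disjoint (B.sector r₀ i) (B.sector r₀ j) := by
  refine fun i j hij => Set.disjoint_left.2 ?_
  rintro _ ⟨p, hp, rfl⟩ ⟨q, hq, hpq⟩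
  exact hij (B.eq_of_coneMap_arc_eq hS hstar hp hq hpq.symm).1

theorem measurableSet_sector (hS : IsClosed S) (hstar : StarConvex ℝ r₀ S) (i : Fin B.n) :
    MeasurableSet (B.sector r₀ i) := by
  refine ((B.measurableSet_transversalTimes r₀ i).prod
    measurableSet_Ioc).image_of_continuousOn_injOn (fun p hp => ?_)
      (B.injOn_coneMap_arc hS hstar i)
  have hsub := B.transversalTimes_subset_Icc r₀ i
  exact (hasFDerivWithinAt_coneMap (B.hasDerivWithinAt_arc i (hsub hp.1))).continuousWithinAt.mono
    (prod_mono hsub (subset_univ _))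

theorem iUnion_sector_ae_eq (hS : IsCompact S) (hstar : StarConvex ℝ r₀ S) :
    ⋃ i, B.sector r₀ i =ᵐ[volume] S := by
  have hsub : ⋃ i, B.sector r₀ i ⊆ S := iUnion_subset (B.sector_subset hS.isClosed hstar)
  refine hsub.eventuallyLE.antisymm (ae_le_set.2 ?_)
  refine measure_mono_null ?_ <| measure_union_null (measure_singleton r₀) <|
    measure_iUnion_null (B.volume_coneMap_image_sdiff_transversalTimes hS.isClosed hstar)
  rintro r ⟨hr, hr'⟩
  refine or_iff_not_imp_left.2 fun hne => ?_
  obtain ⟨i, p, hp, rfl⟩ := B.exists_coneMap_arc_eq hS hr hne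
  refine mem_iUnion_of_mem i (mem_image_of_mem _ ⟨⟨hp.1, fun ht => hr' ?_⟩, mem_univ _⟩)
  exact mem_iUnion_of_mem i (mem_image_of_mem _ ⟨ht, hp.2⟩)

theorem integrand_mul_cross (F : Plane → ℝ) (r₀ : Plane) (i : Fin B.n) {t : ℝ}
    (ht : t ∈ Icc (0 : ℝ) 1) :
    B.integrand (fun r τ => F r * cross (r - r₀) τ) i t =
      F (B.arc i t) * cross (B.arc i t - r₀) (B.velocity i t) := by
  have hv : ‖B.velocity i t‖ ≠ 0 := norm_ne_zero_iff.2 (B.velocity_ne_zero i ht)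
  simp only [integrand, unitTangent, cross_smul]
  field_simp

variable {f : Plane → ℝ}

theorem intervalIntegrable_integrand_and_setIntegral_sector (hS : IsClosed S)
    (hstar : StarConvex ℝ r₀ S) (hf : IntegrableOn f S) (i : Fin B.n) :
    IntervalIntegrable (B.integrand (fun r τ => radialIntegral f r₀ r * cross (r - r₀) τ) i)
      volume 0 1 ∧
    ∫ r in B.sector r₀ i, f r =
      ∫ t in (0 : ℝ)..1, B.integrand (fun r τ => radialIntegral f r₀ r * cross (r - r₀) τ) i t := by
  have hsub := B.transversalTimes_subset_Icc r₀ i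
  have hIoo : B.transversalTimes r₀ i ⊆ Ioo 0 1 := sep_subset _ _
  obtain ⟨hint, hsector⟩ := integrableOn_and_setIntegral_coneMap_image
    (B.measurableSet_transversalTimes r₀ i)
    (fun t ht => (B.hasDerivWithinAt_arc i (hsub ht)).mono hsub) (fun t ht => ht.2.le)
    (B.injOn_coneMap_arc hS hstar i) (hf.mono_set (B.sector_subset hS hstar i))
  have hintegrand : EqOn (B.integrand (fun r τ => radialIntegral f r₀ r * cross (r - r₀) τ) i)
      (fun t => radialIntegral f r₀ (B.arc i t) * cross (B.arc i t - r₀) (B.velocity i t))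
      (Ioo 0 1) := fun t ht => B.integrand_mul_cross _ r₀ i (Ioo_subset_Icc_self ht)
  have hzero : ∀ t ∈ Ioo (0 : ℝ) 1 \ B.transversalTimes r₀ i,
      radialIntegral f r₀ (B.arc i t) * cross (B.arc i t - r₀) (B.velocity i t) = 0 :=
    fun t ht => by rw [B.cross_velocity_eq_zero hS hstar i ht.1 ht.2, mul_zero]
  constructor
  · rw [intervalIntegrable_iff_integrableOn_Ioo_of_le zero_le_one,
      integrableOn_congr_fun hintegrand measurableSet_Ioo]
    exact hint.of_forall_sdiff_eq_zero measurableSet_Ioo hzero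
  · rw [sector, hsector, intervalIntegral.integral_of_le zero_le_one,
      integral_Ioc_eq_integral_Ioo, setIntegral_congr_fun measurableSet_Ioo hintegrand,
      setIntegral_eq_of_subset_of_forall_sdiff_eq_zero measurableSet_Ioo hIoo hzero]

theorem boundaryIntegrable_radialIntegral_mul_cross (hS : IsClosed S) (hstar : StarConvex ℝ r₀ S)
    (hf : IntegrableOn f S) :
    B.BoundaryIntegrable fun r τ => radialIntegral f r₀ r * cross (r - r₀) τ :=
  fun i => (B.intervalIntegrable_integrand_and_setIntegral_sector hS hstar hf i).1

theorem setIntegral_eq_boundaryIntegral_radialIntegral_mul_cross (hS : IsCompact S)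
    (hstar : StarConvex ℝ r₀ S) (hf : IntegrableOn f S) :
    ∫ r in S, f r = B.boundaryIntegral fun r τ => radialIntegral f r₀ r * cross (r - r₀) τ :=
  calc ∫ r in S, f r = ∫ r in ⋃ i, B.sector r₀ i, f r :=
        (setIntegral_congr_set (B.iUnion_sector_ae_eq hS hstar)).symm
    _ = ∑ i, ∫ r in B.sector r₀ i, f r :=
        integral_iUnion_fintype (B.measurableSet_sector hS.isClosed hstar)
          (B.pairwise_disjoint_sector hS.isClosed hstar)
          fun i => hf.mono_set (B.sector_subset hS.isClosed hstar i)
    _ = B.boundaryIntegral fun r τ => radialIntegral f r₀ r * cross (r - r₀) τ :=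
        Finset.sum_congr rfl fun i _ =>
          (B.intervalIntegrable_integrand_and_setIntegral_sector hS.isClosed hstar hf i).2

end PiecewiseSmoothBoundary

theorem IsWeaklySingular.exists_isBigO_mul {K ρ : Plane → ℝ} (hKsing : IsWeaklySingular K)
    (hK : ContinuousOn K {0}ᶜ) {S : Set Plane} (hS : IsCompact S) (hρ : ContinuousOn ρ S)
    (r₀ : Plane) : ∃ α < (2 : ℝ),
      (fun r => K (r - r₀) * ρ r) =O[𝓟 (S \ {r₀})] fun r => ‖r - r₀‖ ^ (-α) := by
  obtain ⟨α, hα, D, -, hbound⟩ := hKsing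
  have hmaps : MapsTo (fun r => r - r₀) (S \ {r₀}) {0}ᶜ := fun r hr => sub_ne_zero.2 hr.2
  have htendsto : Tendsto (fun r => r - r₀) (𝓝[S \ {r₀}] r₀) (𝓝[≠] 0) :=
    tendsto_nhdsWithin_iff.2 ⟨((continuous_sub_right r₀).tendsto' r₀ 0 (sub_self r₀)).mono_left
      nhdsWithin_le_nhds, eventually_mem_nhdsWithin.mono hmaps⟩
  have hKO : K =O[𝓝[≠] 0] fun r => ‖r‖ ^ (-α) := .of_bound D <| hbound.mono fun r hr => by
    rwa [Real.norm_of_nonneg (Real.rpow_nonneg (norm_nonneg r) (-α))]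
  have hKS : (fun r => K (r - r₀)) =O[𝓟 (S \ {r₀})] fun r => ‖r - r₀‖ ^ (-α) := by
    refine isBigO_principal_sdiff_singleton hS (hK.comp (by fun_prop) hmaps) ?_ ?_
      (hKO.comp_tendsto htendsto)
    · exact ContinuousOn.rpow_const (by fun_prop) fun r hr => Or.inl (norm_ne_zero_iff.2 (hmaps hr))
    · exact fun r hr => (Real.rpow_pos_of_pos (norm_pos_iff.2 (hmaps hr)) _).ne'
  have hρO : ρ =O[𝓟 (S \ {r₀})] fun _ => (1 : ℝ) :=
    (hρ.isBigO_principal hS (norm_ne_zero_iff.2 one_ne_zero)).mono (principal_mono.2 sdiff_subset)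
  exact ⟨α, hα, by simpa using hKS.mul hρO⟩

theorem mainTheorem1_general
    (K : Plane → ℝ) (hKsing : IsWeaklySingular K) (hK : ContinuousOn K {0}ᶜ)
    (S : Set Plane) (hS : IsCompact S) (B : PiecewiseSmoothBoundary S)
    (ρ : Plane → ℝ) (hρ : ContinuousOn ρ S) (r₀ : Plane) (hstar : StarConvex ℝ r₀ S) :
    IntegrableOn (fun r => K (r - r₀) * ρ r) S volume ∧
    (∀ r ∈ frontier S, IntervalIntegrable
      (fun t : ℝ => t * K (t • (r - r₀)) * ρ (t • (r - r₀) + r₀)) volume 0 1) ∧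
    B.BoundaryIntegrable (fun r τ =>
      (∫ t in (0 : ℝ)..1, t * K (t • (r - r₀)) * ρ (t • (r - r₀) + r₀)) * cross (r - r₀) τ) ∧
    ∫ r in S, K (r - r₀) * ρ r =
      B.boundaryIntegral (fun r τ =>
        (∫ t in (0 : ℝ)..1, t * K (t • (r - r₀)) * ρ (t • (r - r₀) + r₀)) *
          cross (r - r₀) τ) := by
  obtain ⟨α, hα, hO⟩ := hKsing.exists_isBigO_mul hK hS hρ r₀
  have hcont : ContinuousOn (fun r => K (r - r₀) * ρ r) (S \ {r₀}) :=
    (hK.comp (by fun_prop) fun r hr => sub_ne_zero.2 hr.2).mul (hρ.mono sdiff_subset)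
  have hint : IntegrableOn (fun r => K (r - r₀) * ρ r) S :=
    integrableOn_of_isBigO_norm_sub_rpow hS hcont (by simpa using hα) hO
  have hradial := fun r (hr : r ∈ frontier S) =>
    intervalIntegrable_mul_comp_smul_sub_add hstar hcont hα hO (hS.isClosed.frontier_subset hr)
  have hboundary := B.boundaryIntegrable_radialIntegral_mul_cross hS.isClosed hstar hint
  have hformula := B.setIntegral_eq_boundaryIntegral_radialIntegral_mul_cross hS hstar hint
  simp only [radialIntegral, add_sub_cancel_right, ← mul_assoc] at hradial hboundary hformula
  exact ⟨hint, hradial, hboundary, hformula⟩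

theorem mainTheorem1
    (K : Plane → ℝ) (hKsing : IsWeaklySingular K) (hK : ContDiffOn ℝ 1 K {0}ᶜ)
    (S : Set Plane) (hS : IsCompact S) (B : PiecewiseSmoothBoundary S)
    (ρ : Plane → ℝ) (hρ : ContDiffOn ℝ 1 ρ S)
    (r₀ : Plane) (hr₀ : r₀ ∈ S) (hstar : StarConvex ℝ r₀ S) :
    IntegrableOn (fun r => K (r - r₀) * ρ r) S volume ∧
    (∀ r ∈ frontier S, IntervalIntegrable
      (fun t : ℝ => t * K (t • (r - r₀)) * ρ (t • (r - r₀) + r₀)) volume 0 1) ∧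
    B.BoundaryIntegrable (fun r τ =>
      (∫ t in (0 : ℝ)..1, t * K (t • (r - r₀)) * ρ (t • (r - r₀) + r₀)) * cross (r - r₀) τ) ∧
    ∫ r in S, K (r - r₀) * ρ r =
      B.boundaryIntegral (fun r τ =>
        (∫ t in (0 : ℝ)..1, t * K (t • (r - r₀)) * ρ (t • (r - r₀) + r₀)) *
          cross (r - r₀) τ) :=
  mainTheorem1_general K hKsing hK.continuousOn S hS B ρ hρ.continuousOn r₀ hstar
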